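/- Consider a source, a destination and $N\ge 2$ energy-harvesting decode-and-forward relays. The channel gains $g_{\mathrm{sr}_i}$ (source to relay $i$) and $g_{\mathrm{r}_i\mathrm{d}}$ (relay $i$ to destination), $1\le i\le N$, are independent exponential random variables with means $\lambda_{\mathrm{sr}}>0$ and $\lambda_{\mathrm{rd}}>0$, respectively (Rayleigh fading). Let $\theta\in(0,1)$, code rate $R>0$ (in nats), power-amplifier inefficiency $\nu\ge 1$, circuit powers $P_{\mathrm{proc}},P_{\mathrm{active}}\ge 0$, and $\gamma=e^{2R/\theta}-1$. All noise variances and the block length are $1$. In opportunistic relaying with perfect CSI the relay $i^*\in\arg\max_{1\le i\le N}\min\{g_{\mathrm{sr}_i},g_{\mathrm{r}_i\mathrm{d}}\}$ is used. It harvests the energy $(1-\theta)P_{\mathrm s}^{\mathrm e}\,g_{\mathrm{sr}_{i^*}}$ from the source's energy signal of power $P_{\mathrm s}^{\mathrm e}$ and forwards the message with the power $P_{\mathrm r}$ determined by $\frac{\theta}{2}(P_{\mathrm{active}}+\nu P_{\mathrm r})=(1-\theta)P_{\mathrm s}^{\mathrm e}\,g_{\mathrm{sr}_{i^*}}-\frac{\theta}{2}P_{\mathrm{proc}}$.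 There is an outage if the harvested energy is less than $\frac{\theta}{2}(P_{\mathrm{proc}}+P_{\mathrm{active}})$, or if $\frac{\theta}{2}\log\bigl(1+\min\{g_{\mathrm{sr}_{i^*}}P_{\mathrm s}^{\mathrm i},\,g_{\mathrm{r}_{i^*}\mathrm{d}}P_{\mathrm r}\}\bigr)<R$, where $P_{\mathrm s}^{\mathrm i}$ is the power of the source's information signal. Let $P_{\mathrm s}^{\mathrm i}=P_{\mathrm s}^{\mathrm e}=P$ and let $\Pr(\mathrm{outage})$ be the outage probability as a function of $P$. Put $$S_{N+1}=\sum_{k=0}^{N}\binom Nk(-1)^k k^{N+1},\qquad \Phi_l(a,b)=\Bigl(\frac{a+b}{b}\Bigr)^{l}\sum_{k=0}^{N-1}\binom{N-1}{k}(-1)^k k^l,$$ $$\begin{aligned}\Omega_N={}&\frac{S_{N+1}(-1)^{N+1}(\lambda_{\mathrm{sr}}+\lambda_{\mathrm{rd}})^{N+1}}{(N+1)!\,(\lambda_{\mathrm{sr}}\lambda_{\mathrm{rd}})^{N+1}}+\frac{2N(\lambda_{\mathrm{sr}}+\lambda_{\mathrm{rd}})^{N-1}}{(N-1)(\lambda_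{\mathrm{sr}}\lambda_{\mathrm{rd}})^{N}}\\&-\frac{N(-1)^N}{(N+1)!\,(\lambda_{\mathrm{sr}}\lambda_{\mathrm{rd}})^{N+1}}\Bigl[\lambda_{\mathrm{rd}}^{N+1}\bigl(N\Phi_{N-1}(\lambda_{\mathrm{sr}},\lambda_{\mathrm{rd}})+\Phi_N(\lambda_{\mathrm{sr}},\lambda_{\mathrm{rd}})\bigr)+\lambda_{\mathrm{sr}}^{N+1}\bigl(N\Phi_{N-1}(\lambda_{\mathrm{rd}},\lambda_{\mathrm{sr}})+\Phi_N(\lambda_{\mathrm{rd}},\lambda_{\mathrm{sr}})\bigr)\Bigr].\end{aligned}$$ Then: 1. as $P\to\infty$, $\Pr(\mathrm{outage})\sim\Omega_N\left(\frac{\gamma\nu\theta}{2(1-\theta)}\right)^{\frac{N+1}{2}}P^{-\frac{N+1}{2}}$, that is, the ratio of the two sides tends to $1$; 2. the diversity order is $\frac{N+1}{2}$: $\;-\log\Pr(\mathrm{outage})/\log P\to\frac{N+1}{2}$ as $P\to\infty$; 3. the outage probability at high SNR grows as $\nu^{(N+1)/2}$: if $\nu$ is replaced by $\nu'\ge 1$,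 all else being unchanged, then the ratio of the new outage probability to the old one tends to $(\nu'/\nu)^{(N+1)/2}$ as $P\to\infty$. -/

import Mathlib

open MeasureTheory ProbabilityTheory Filter Topology Asymptotics

noncomputable section

/-- Parameters of the two-hop network with energy-harvesting relays. The block length, the noise
variances and the harvesting efficiency are normalised to one. -/
structure RelayNetwork where
  /-- fraction of the block used for information transfer (half of it for each hop) -/
  θ : ℝ
  /-- code rate, in nats per channel use -/
  R : ℝ
  /-- inefficiency of the power amplifier of the relays -/
  ν : ℝ
  /-- processing power of a relay -/
  Pproc : ℝ
  /-- bias power of a relay during data transmission -/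
  Pactive : ℝ
  /-- mean channel gain of a source-relay link -/
  lamSR : ℝ
  /-- mean channel gain of a relay-destination link -/
  lamRD : ℝ

namespace RelayNetwork

variable (S : RelayNetwork)

/-- The SNR threshold `γ = exp (2 R / θ) - 1`. -/
def gam : ℝ := Real.exp (2 * S.R / S.θ) - 1

/-- Energy harvested by a relay whose source-relay gain is `x`, at source energy-signal power
`Pe`. -/
def harvested (Pe x : ℝ) : ℝ := (1 - S.θ) * Pe * x

/-- Energy that a relay spends on processing and on the bias of its amplifier. -/
def circuitEnergy : ℝ := S.θ / 2 * (S.Pproc + S.Pactive)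

/-- Transmission power of a power-adaptive relay, which uses up all its remaining energy: the
solution `Pr` of `(Pactive + ν Pr) θ / 2 = harvested energy - Pproc θ / 2`. -/
def relayPower (Pe x : ℝ) : ℝ := (S.harvested Pe x - S.circuitEnergy) / (S.ν * (S.θ / 2))

/-- The harvested energy does not cover the needs of the relay circuits. -/
def CircuitOutage (Pe x : ℝ) : Prop := S.harvested Pe x < S.circuitEnergy

/-- The relay or the destination cannot decode: the decode-and-forward rate, determined by the
smaller of the SNRs `x * Pinf` and `y * relayPower` of the two hops, is below the code rate. -/
def RateOutage (Pinf Pe x y : ℝ) : Prop :=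
  S.θ / 2 * Real.log (1 + min (x * Pinf) (y * S.relayPower Pe x)) < S.R

/-- Outage of a relay with source-relay gain `x` and relay-destination gain `y`, when the source
uses power `Pinf` for the information signal and `Pe` for the energy signal. -/
def Outage (Pinf Pe x y : ℝ) : Prop := S.CircuitOutage Pe x ∨ S.RateOutage Pinf Pe x y

/-- Rayleigh fading: all channel gains are independent and exponentially distributed, with mean
`lamSR` on the source-relay links and mean `lamRD` on the relay-destination links (`expMeasure`
takes the rate, that is, the inverse of the mean). -/
structure IsRayleigh {Ω : Type*} [MeasurableSpace Ω] (μ : Measure Ω) {N : ℕ}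
    (gsr grd : Fin N → Ω → ℝ) : Prop where
  law_sr : ∀ i, HasLaw (gsr i) (expMeasure (1 / S.lamSR)) μ
  law_rd : ∀ i, HasLaw (grd i) (expMeasure (1 / S.lamRD)) μ
  indep : iIndepFun (Sum.elim gsr grd) μ

/-- Outage probability when the relay with the (random) index `sel` is used. -/
def outageProb {Ω : Type*} [MeasurableSpace Ω] (μ : Measure Ω) {N : ℕ}
    (gsr grd : Fin N → Ω → ℝ) (sel : Ω → Fin N) (Pinf Pe : ℝ) : ℝ :=
  μ.real {ω | S.Outage Pinf Pe (gsr (sel ω) ω) (grd (sel ω) ω)}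

end RelayNetwork

/-- Opportunistic relaying with perfect CSI: `sel` is an argmax of `min (gsr i) (grd i)` over the
relays `i` (with an arbitrary choice in the case of ties). -/
def IsOpportunistic {Ω : Type*} {N : ℕ} (gsr grd : Fin N → Ω → ℝ) (sel : Ω → Fin N) : Prop :=
  ∀ ω i, min (gsr i ω) (grd i ω) ≤ min (gsr (sel ω) ω) (grd (sel ω) ω)

/-- The outage probability `p`, as a function of the SNR `P`, has diversity order `d`. -/
def HasDiversityOrder (p : ℝ → ℝ) (d : ℝ) : Prop :=
  Tendsto (fun P => -Real.log (p P) / Real.log P) atTop (𝓝 d)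

/-- `∑ k = 0, ..., N, binom N k * (-1) ^ k * k ^ (N + 1)`. -/
def binomSum (N : ℕ) : ℝ :=
  ∑ k ∈ Finset.range (N + 1), (N.choose k : ℝ) * (-1) ^ k * (k : ℝ) ^ (N + 1)

/-- `((a + b) / b) ^ l * ∑ k = 0, ..., N - 1, binom (N - 1) k * (-1) ^ k * k ^ l`. -/
def phiSum (N : ℕ) (a b : ℝ) (l : ℕ) : ℝ :=
  ((a + b) / b) ^ l *
    ∑ k ∈ Finset.range N, ((N - 1).choose k : ℝ) * (-1) ^ k * (k : ℝ) ^ l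

/-- The high-SNR constant, for `N ≥ 2` relays and mean gains `a` (source-relay) and `b`
(relay-destination). -/
def omegaConst (N : ℕ) (a b : ℝ) : ℝ :=
  binomSum N * (-1) ^ (N + 1) * (a + b) ^ (N + 1) / ((N + 1).factorial * (a * b) ^ (N + 1))
  - N * (-1) ^ N / ((N + 1).factorial * (a * b) ^ (N + 1)) *
      (b ^ (N + 1) * (N * phiSum N a b (N - 1) + phiSum N a b N)
        + a ^ (N + 1) * (N * phiSum N b a (N - 1) + phiSum N b a N))
  + 2 * N * (a + b) ^ (N - 1) / (((N : ℝ) - 1) * (a * b) ^ N)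

end

/-! Write `x`, `y` for the two gains of the selected relay and `K = γνθ / (2(1-θ))`. Without circuit
consumption the relay power is `2(1-θ)Px / (νθ)`, so the second hop fails exactly when `xy < K / P`.
This event governs the outage probability. It implies outage (`outage_of_mul_lt`). Conversely, for
each `q < 1` there is a constant `C` such that outage with `x > C / P` forces `xy < K / (qP)`
(`mul_lt_of_outage`). The exceptional event `x ≤ C / P` forces every relay to have a weak hop, so it
has probability `O(P ^ (-N))` (`measure_selected_le`), which is negligible against `P ^ (-(N+1)/2)`
because `N ≥ 2`. Then `q → 1`.

Put `s ^ 2 = K / P` and `n = N - 1`. By symmetry over the relays and according to which hop is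
weaker, the probability of `xy < s ^ 2` is exactly `N` times a sum of two integrals
`weakHopIntegral` (`measure_selected_mul_lt`). In the dominant regime both gains of the best relay
are of order `s`, which costs `s ^ 2`, and the other `n` relays have a hop below that scale, which
costs `s ^ n`; hence the order `s ^ (N+1)`. Rescaling and dominated convergence give the constant
(`tendsto_weakHopIntegral`), and evaluating the alternating binomial sums identifies it with
`omegaConst` (`omegaConst_eq`). -/

/-! ### Alternating binomial sums and the closed form of the constant. -/

/-- `∑ k ≤ n, binom n k * (-1) ^ k * k ^ l`. -/
def altBinomSum (n l : ℕ) : ℝ :=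
  ∑ k ∈ Finset.range (n + 1), (n.choose k : ℝ) * (-1) ^ k * (k : ℝ) ^ l

/-- Pascal's rule, term by term; the `k = 0` term `0 ^ l` is common to both sums on the right and
cancels. -/
theorem altBinomSum_shift (n l : ℕ) :
    ∑ k ∈ Finset.range (n + 1), (n.choose k : ℝ) * (-1) ^ k * ((k : ℝ) + 1) ^ l
      = altBinomSum n l - altBinomSum (n + 1) l := by
  have h : altBinomSum n l = ∑ k ∈ Finset.range (n + 1),
      (n.choose (k + 1) : ℝ) * (-1) ^ (k + 1) * ((k : ℝ) + 1) ^ l + (0 : ℝ) ^ l := by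
    unfold altBinomSum
    rw [Finset.sum_range_succ', Finset.sum_range_succ _ n]
    simp
  rw [h, altBinomSum, Finset.sum_range_succ' _ (n + 1)]
  simp only [Nat.cast_zero, Nat.choose_zero_right, Nat.cast_one, pow_zero, one_mul]
  rw [add_sub_add_right_eq_sub, ← Finset.sum_sub_distrib]
  refine Finset.sum_congr rfl fun k _ => ?_
  rw [Nat.choose_succ_succ]
  push_cast
  ring

/-- Absorption, `(k+1) * binom (n+1) (k+1) = (n+1) * binom n k`, followed by the shift. This
recursion yields the values for `l < n`, `l = n` and `l = n + 1`. -/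
theorem altBinomSum_succ_succ (n l : ℕ) :
    altBinomSum (n + 1) (l + 1) = -(n + 1) * (altBinomSum n l - altBinomSum (n + 1) l) := by
  rw [← altBinomSum_shift, altBinomSum, Finset.sum_range_succ', Finset.mul_sum]
  simp only [Nat.cast_zero, zero_pow (Nat.succ_ne_zero l), mul_zero, add_zero]
  refine Finset.sum_congr rfl fun k _ => ?_
  have h : ((n : ℝ) + 1) * n.choose k = (n + 1).choose (k + 1) * ((k : ℝ) + 1) := by
    exact_mod_cast Nat.add_one_mul_choose_eq n k
  push_cast
  linear_combination -(-1) ^ (k + 1) * ((k : ℝ) + 1) ^ l * h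

theorem altBinomSum_succ_zero (n : ℕ) : altBinomSum (n + 1) 0 = 0 := by
  have h := altBinomSum_shift n 0
  simp only [pow_zero, altBinomSum] at h ⊢
  linarith

theorem altBinomSum_of_lt {n l : ℕ} (h : l < n) : altBinomSum n l = 0 := by
  induction l generalizing n with
  | zero => obtain ⟨n, rfl⟩ := Nat.exists_eq_add_one.2 h; exact altBinomSum_succ_zero n
  | succ l ih =>
    obtain ⟨n, rfl⟩ := Nat.exists_eq_add_one.2 (Nat.zero_lt_of_lt h)
    rw [altBinomSum_succ_succ, ih (by omega), ih (by omega)]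
    ring

theorem altBinomSum_self (n : ℕ) : altBinomSum n n = (-1) ^ n * n.factorial := by
  induction n with
  | zero => simp [altBinomSum]
  | succ n ih =>
    rw [altBinomSum_succ_succ, ih, altBinomSum_of_lt (Nat.lt_succ_self n), Nat.factorial_succ]
    push_cast
    ring

theorem altBinomSum_self_succ (n : ℕ) :
    altBinomSum n (n + 1) = (-1) ^ n * (n + 1).factorial * n / 2 := by
  induction n with
  | zero => simp [altBinomSum]
  | succ n ih =>
    rw [altBinomSum_succ_succ, ih, altBinomSum_self, Nat.factorial_succ (n + 1)]
    push_cast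
    ring

/-- Every alternating sum inside `omegaConst` has its power equal to the upper binomial index or one
more, so all of them are known explicitly. -/
theorem omegaConst_eq {N : ℕ} (hN : 2 ≤ N) {a b : ℝ} (ha : 0 < a) (hb : 0 < b) :
    omegaConst N a b
      = 4 * N * (a + b) ^ (N - 1) / (((N : ℝ) ^ 2 - 1) * (a * b) ^ N) := by
  obtain ⟨n, rfl⟩ : ∃ n, N = n + 2 := ⟨N - 2, by omega⟩
  have hbin : binomSum (n + 2) = altBinomSum (n + 2) (n + 2 + 1) := rfl
  have hphi : ∀ x y l, phiSum (n + 2) x y l = ((x + y) / y) ^ l * altBinomSum (n + 1) l :=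
    fun _ _ _ => rfl
  have h1 : n + 2 - 1 = n + 1 := rfl
  rw [omegaConst, hbin, h1]
  simp only [hphi]
  rw [altBinomSum_self_succ, altBinomSum_self, altBinomSum_self_succ, add_comm b a]
  have hs : ((-1 : ℝ) ^ n) ^ 2 = 1 := by rw [← pow_mul, mul_comm, pow_mul]; simp
  have hf : ((n + 1).factorial : ℝ) ≠ 0 := by positivity
  simp only [Nat.factorial_succ (n + 2), Nat.factorial_succ (n + 1), div_pow, mul_pow, pow_succ]
  push_cast
  have hA : a ^ n ≠ 0 := by positivity
  have hB : b ^ n ≠ 0 := by positivity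
  have hx : (0 : ℝ) ≤ n := Nat.cast_nonneg n
  -- All powers with exponent `n` become independent symbols; what remains is a rational identity
  -- modulo `s ^ 2 = 1`, where `s` stands for `(-1) ^ n`.
  generalize (n : ℝ) = x at *
  have hn : x + 2 - 1 ≠ 0 := by linarith
  have hn2 : (x + 2) * (x + 2) - 1 ≠ 0 := by nlinarith
  generalize a ^ n = A at *
  generalize b ^ n = B at *
  generalize (a + b) ^ n = T at *
  generalize ((n + 1).factorial : ℝ) = f at *
  generalize (-1 : ℝ) ^ n = s at *
  simp only [one_mul, pow_zero]
  have h3 : x + 2 + 1 ≠ 0 := by linarith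
  have h2 : x + 1 + 1 ≠ 0 := by linarith
  have h4 : x + 2 ≠ 0 := by linarith
  have e : (x + 2) * (x + 2) - 1 = (x + 2 - 1) * (x + 2 + 1) := by ring
  rw [e]
  have h5 : x + 1 + 1 = x + 2 := by ring
  rw [h5]
  field_simp
  ring_nf
  simp only [hs]
  ring

/-! ### Small-`s` asymptotics of the weak-hop integral. -/

/-- For independent exponential gains of rates `a` (first hop) and `b` (second hop), the probability
that a given relay is the best one of `n + 1`, its first hop is the weaker one, and the product of
its two gains is below `s ^ 2`. -/
noncomputable def weakHopIntegral (a b : ℝ) (n : ℕ) (s : ℝ) : ℝ :=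
  ∫ x in (0 : ℝ)..s, a * Real.exp (-(a * x)) *
    ((1 - Real.exp (-((a + b) * x))) ^ n * (Real.exp (-(b * x)) - Real.exp (-(b * (s ^ 2 / x)))))

theorem tendsto_one_sub_exp_div (k : ℝ) :
    Tendsto (fun s : ℝ => (1 - Real.exp (-(k * s))) / s) (𝓝[>] 0) (𝓝 k) := by
  have h : HasDerivAt (fun s : ℝ => 1 - Real.exp (-(k * s))) k 0 := by
    have := (((hasDerivAt_id (0 : ℝ)).const_mul k).neg.exp).const_sub 1
    simpa using this
  have h' := h.tendsto_slope_zero_right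
  refine h'.congr fun s => ?_
  simp [div_eq_inv_mul]

theorem one_sub_exp_div_le {k s : ℝ} (hs : 0 < s) : (1 - Real.exp (-(k * s))) / s ≤ k := by
  rw [div_le_iff₀ hs]
  linarith [Real.add_one_le_exp (-(k * s))]

/-- Substitution `x = s * t`: one factor `s` comes from `dx`, `n` from the power, and one from the
difference of exponentials, rewritten as a difference of two quotients `(1 - exp (-(k * s))) / s`
with limits `k`. -/
theorem weakHopIntegral_div_pow (a b : ℝ) (n : ℕ) {s : ℝ} (hs : 0 < s) :
    weakHopIntegral a b n s / s ^ (n + 2) = ∫ t in (0 : ℝ)..1, a * Real.exp (-(a * (s * t))) *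
      (((1 - Real.exp (-((a + b) * t * s))) / s) ^ n *
        ((1 - Real.exp (-(b / t * s))) / s - (1 - Real.exp (-(b * t * s))) / s)) := by
  have h := intervalIntegral.smul_integral_comp_mul_left (a := 0) (b := 1)
    (fun x => a * Real.exp (-(a * x)) *
      ((1 - Real.exp (-((a + b) * x))) ^ n * (Real.exp (-(b * x)) - Real.exp (-(b * (s ^ 2 / x))))))
    s
  rw [mul_zero, mul_one] at h
  rw [weakHopIntegral, ← h, smul_eq_mul, mul_div_right_comm, ← intervalIntegral.integral_const_mul]
  congr 1
  ext t
  have e1 : s ^ 2 / (s * t) = s / t := by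
    rw [pow_two, mul_div_mul_left _ _ hs.ne']
  have e2 : b / t * s = b * (s / t) := by ring
  have e3 : (a + b) * t * s = (a + b) * (s * t) := by ring
  have e4 : b * t * s = b * (s * t) := by ring
  rw [e1, e2, e3, e4, div_pow]
  field_simp
  ring

theorem tendsto_weakHopIntegral {a b : ℝ} (ha : 0 < a) (hb : 0 < b) {n : ℕ} (hn : 1 ≤ n) :
    Tendsto (fun s => weakHopIntegral a b n s / s ^ (n + 2)) (𝓝[>] 0)
      (𝓝 (a * b * (a + b) ^ n * (1 / n - 1 / (n + 2)))) := by
  have hlim : ∫ t in (0 : ℝ)..1, a * (((a + b) * t) ^ n * (b / t - b * t))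
      = a * b * (a + b) ^ n * (1 / n - 1 / (n + 2)) := by
    obtain ⟨m, rfl⟩ := Nat.exists_eq_add_one.2 hn
    have h : ∀ t ∈ Set.uIoc (0 : ℝ) 1, a * (((a + b) * t) ^ (m + 1) * (b / t - b * t))
        = a * b * (a + b) ^ (m + 1) * (t ^ m - t ^ (m + 2)) := by
      intro t ht
      rw [Set.uIoc_of_le zero_le_one] at ht
      have := ht.1.ne'
      rw [mul_pow]
      field_simp
      ring
    rw [intervalIntegral.integral_congr_ae (Eventually.of_forall h),
      intervalIntegral.integral_const_mul, intervalIntegral.integral_sub (by simp) (by simp),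
      integral_pow, integral_pow]
    push_cast
    simp
    left
    ring
  rw [← hlim]
  have hpos : ∀ᶠ s : ℝ in 𝓝[>] 0, 0 < s := self_mem_nhdsWithin
  refine Tendsto.congr' (hpos.mono fun s hs => (weakHopIntegral_div_pow a b n hs).symm) ?_
  -- A constant dominates: `1 - exp (-u) ≤ u` bounds the quotients, and since `n ≥ 1` the factor `t
  -- ^ n` absorbs the singularity of `b / t`.
  refine intervalIntegral.tendsto_integral_filter_of_dominated_convergence
    (fun _ => a * ((a + b) ^ n * b)) ?_ ?_ (by simp) ?_
  · exact Eventually.of_forall fun s => Measurable.aestronglyMeasurable (by fun_prop)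
  · refine hpos.mono fun s hs => Eventually.of_forall fun t ht => ?_
    rw [Set.uIoc_of_le zero_le_one] at ht
    obtain ⟨ht0, ht1⟩ := ht
    have hst := mul_pos hs ht0
    have h1 : 0 ≤ (1 - Real.exp (-((a + b) * t * s))) / s :=
      div_nonneg (sub_nonneg.2 (Real.exp_le_one_iff.2 (by
        have : 0 ≤ (a + b) * t * s := by positivity
        linarith))) hs.le
    have h2 : 0 ≤ (1 - Real.exp (-(b * t * s))) / s :=
      div_nonneg (sub_nonneg.2 (Real.exp_le_one_iff.2 (by
        have : 0 ≤ b * t * s := by positivity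
        linarith))) hs.le
    have h3 : (1 - Real.exp (-(b * t * s))) / s ≤ (1 - Real.exp (-(b / t * s))) / s := by
      gcongr
      rw [div_eq_mul_inv]
      gcongr
      exact ht1.trans ((one_le_inv₀ ht0).2 ht1)
    rw [Real.norm_of_nonneg (by
      have := sub_nonneg.2 h3
      positivity)]
    have h4 : (((1 - Real.exp (-((a + b) * t * s))) / s) ^ n *
        ((1 - Real.exp (-(b / t * s))) / s - (1 - Real.exp (-(b * t * s))) / s))
        ≤ ((a + b) * t) ^ n * (b / t) := by
      have := sub_nonneg.2 h3
      gcongr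
      · exact one_sub_exp_div_le hs
      · linarith [one_sub_exp_div_le (k := b / t) hs]
    have h5 : ((a + b) * t) ^ n * (b / t) ≤ (a + b) ^ n * b := by
      obtain ⟨m, rfl⟩ := Nat.exists_eq_add_one.2 hn
      have : ((a + b) * t) ^ (m + 1) * (b / t) = (a + b) ^ (m + 1) * b * t ^ m := by
        rw [mul_pow]
        field_simp
        ring
      rw [this]
      exact mul_le_of_le_one_right (by positivity) (pow_le_one₀ ht0.le ht1)
    have h6 : a * Real.exp (-(a * (s * t))) ≤ a :=
      mul_le_of_le_one_right ha.le (Real.exp_le_one_iff.2 (by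
        have : 0 ≤ a * (s * t) := by positivity
        linarith))
    have := sub_nonneg.2 h3
    exact mul_le_mul h6 (h4.trans h5) (by positivity) ha.le
  · refine Eventually.of_forall fun t _ => ?_
    have h0 : Tendsto (fun s : ℝ => a * Real.exp (-(a * (s * t)))) (𝓝[>] 0) (𝓝 a) := by
      have : Continuous fun s : ℝ => a * Real.exp (-(a * (s * t))) := by fun_prop
      simpa using (this.tendsto 0).mono_left nhdsWithin_le_nhds
    exact h0.mul (((tendsto_one_sub_exp_div _).pow n).mul
      ((tendsto_one_sub_exp_div _).sub (tendsto_one_sub_exp_div _)))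

/-! ### Exponential laws and the joint law of the gains of one relay. -/

theorem expMeasure_Iic {r : ℝ} (hr : 0 < r) (x : ℝ) :
    expMeasure r (Set.Iic x) = ENNReal.ofReal (if 0 ≤ x then 1 - Real.exp (-(r * x)) else 0) := by
  have := isProbabilityMeasure_expMeasure hr
  rw [← cdf_expMeasure_eq hr, ofReal_cdf]

theorem expMeasure_Ioi {r : ℝ} (hr : 0 < r) {x : ℝ} (hx : 0 ≤ x) :
    expMeasure r (Set.Ioi x) = ENNReal.ofReal (Real.exp (-(r * x))) := by
  have := isProbabilityMeasure_expMeasure hr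
  rw [← Set.compl_Iic, prob_compl_eq_one_sub measurableSet_Iic, expMeasure_Iic hr, if_pos hx,
    ← ENNReal.ofReal_one, ← ENNReal.ofReal_sub _ (sub_nonneg.2 (Real.exp_le_one_iff.2 (by
      have := mul_nonneg hr.le hx
      linarith)))]
  simp

instance nullSingletonClass_expMeasure (r : ℝ) : NullSingletonClass (expMeasure r) := by
  unfold expMeasure gammaMeasure
  infer_instance

theorem expMeasure_Ici {r : ℝ} (hr : 0 < r) {x : ℝ} (hx : 0 ≤ x) :
    expMeasure r (Set.Ici x) = ENNReal.ofReal (Real.exp (-(r * x))) := by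
  rw [← measure_congr Ioi_ae_eq_Ici, expMeasure_Ioi hr hx]

theorem ae_pos_expMeasure {r : ℝ} (hr : 0 < r) : ∀ᵐ x ∂expMeasure r, 0 < x := by
  rw [ae_iff]
  simp only [not_lt]
  change expMeasure r (Set.Iic 0) = 0
  rw [expMeasure_Iic hr]
  simp

theorem expMeasure_Ico {r : ℝ} (hr : 0 < r) {x y : ℝ} (hx : 0 ≤ x) (hy : 0 ≤ y) :
    expMeasure r (Set.Ico x y)
      = ENNReal.ofReal (Real.exp (-(r * x)) - Real.exp (-(r * y))) := by
  have := isProbabilityMeasure_expMeasure hr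
  rcases le_total x y with h | h
  · rw [← Set.Ici_sdiff_Ici, measure_sdiff (Set.Ici_subset_Ici.2 h)
      measurableSet_Ici.nullMeasurableSet (measure_ne_top _ _), expMeasure_Ici hr hx,
      expMeasure_Ici hr hy, ENNReal.ofReal_sub _ (Real.exp_pos _).le]
  · rw [Set.Ico_eq_empty (not_lt.2 h), measure_empty, eq_comm, ENNReal.ofReal_eq_zero,
      sub_nonpos]
    gcongr

theorem expMeasure_Ioo {r : ℝ} (hr : 0 < r) {x y : ℝ} (hx : 0 ≤ x) (hy : 0 ≤ y) :
    expMeasure r (Set.Ioo x y)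
      = ENNReal.ofReal (Real.exp (-(r * x)) - Real.exp (-(r * y))) := by
  rw [measure_congr Ioo_ae_eq_Ico, expMeasure_Ico hr hx hy]

/-- The joint law of the two gains of a relay, with rates `a` and `b`. -/
noncomputable def gainLaw (a b : ℝ) : Measure (ℝ × ℝ) := (expMeasure a).prod (expMeasure b)

theorem isProbabilityMeasure_gainLaw {a b : ℝ} (ha : 0 < a) (hb : 0 < b) :
    IsProbabilityMeasure (gainLaw a b) := by
  have := isProbabilityMeasure_expMeasure ha
  have := isProbabilityMeasure_expMeasure hb
  unfold gainLaw
  infer_instance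

theorem ae_pos_gainLaw {a b : ℝ} (ha : 0 < a) (hb : 0 < b) :
    ∀ᵐ z ∂gainLaw a b, 0 < z.1 ∧ 0 < z.2 := by
  have := isProbabilityMeasure_expMeasure ha
  have := isProbabilityMeasure_expMeasure hb
  exact (Measure.quasiMeasurePreserving_fst.ae (ae_pos_expMeasure ha)).and
    (Measure.quasiMeasurePreserving_snd.ae (ae_pos_expMeasure hb))

theorem gainLaw_min_lt {a b : ℝ} (ha : 0 < a) (hb : 0 < b) {m : ℝ} (hm : 0 ≤ m) :
    gainLaw a b {w | min w.1 w.2 < m} = ENNReal.ofReal (1 - Real.exp (-((a + b) * m))) := by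
  have := isProbabilityMeasure_expMeasure ha
  have := isProbabilityMeasure_expMeasure hb
  have := isProbabilityMeasure_gainLaw ha hb
  have h : {w : ℝ × ℝ | min w.1 w.2 < m} = (Set.Ici m ×ˢ Set.Ici m)ᶜ := by
    ext w
    simp only [Set.mem_ofPred_eq, Set.mem_compl_iff, Set.mem_prod, Set.mem_Ici, ← le_min_iff, not_le]
  rw [h, prob_compl_eq_one_sub (measurableSet_Ici.prod measurableSet_Ici), gainLaw,
    Measure.prod_prod, expMeasure_Ici ha hm, expMeasure_Ici hb hm,
    ← ENNReal.ofReal_mul (Real.exp_pos _).le, ← Real.exp_add,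
    ENNReal.ofReal_sub _ (Real.exp_pos _).le, ENNReal.ofReal_one]
  congr 3
  ring

theorem gainLaw_min_le {a b : ℝ} (ha : 0 < a) (hb : 0 < b) {m : ℝ} (hm : 0 ≤ m) :
    gainLaw a b {w | min w.1 w.2 ≤ m} = ENNReal.ofReal (1 - Real.exp (-((a + b) * m))) := by
  have := isProbabilityMeasure_expMeasure ha
  have := isProbabilityMeasure_expMeasure hb
  have := isProbabilityMeasure_gainLaw ha hb
  have h : {w : ℝ × ℝ | min w.1 w.2 ≤ m} = (Set.Ioi m ×ˢ Set.Ioi m)ᶜ := by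
    ext w
    simp only [Set.mem_ofPred_eq, Set.mem_compl_iff, Set.mem_prod, Set.mem_Ioi, ← lt_min_iff, not_lt]
  rw [h, prob_compl_eq_one_sub (measurableSet_Ioi.prod measurableSet_Ioi), gainLaw,
    Measure.prod_prod, expMeasure_Ioi ha hm, expMeasure_Ioi hb hm,
    ← ENNReal.ofReal_mul (Real.exp_pos _).le, ← Real.exp_add,
    ENNReal.ofReal_sub _ (Real.exp_pos _).le, ENNReal.ofReal_one]
  congr 3
  ring

/-! ### The probability that a given relay is the best and its product of gains is small. -/

/-- Fubini after splitting off coordinate `i`: given its value `z`, the other `n` coordinates are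
independent and each satisfies `r · z` with the same probability. A general `r` serves both `≤` and
`<`. -/
theorem pi_setOf_forall_ne_rel {α : Type*} [MeasurableSpace α] (Q : Measure α)
    [IsProbabilityMeasure Q] {n : ℕ} (i : Fin (n + 1)) {C : Set α} (hC : MeasurableSet C)
    {r : α → α → Prop} (hr : MeasurableSet {p : α × α | r p.1 p.2}) :
    Measure.pi (fun _ : Fin (n + 1) => Q) {g | g i ∈ C ∧ ∀ j ≠ i, r (g j) (g i)}
      = ∫⁻ z in C, Q {w | r w z} ^ n ∂Q := by
  have hmp := measurePreserving_piFinSuccAbove (fun _ : Fin (n + 1) => Q) i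
  set T : Set (α × (Fin n → α)) := {p | p.1 ∈ C ∧ ∀ j, r (p.2 j) p.1} with hT
  have hTm : MeasurableSet T := by
    have h : T = Prod.fst ⁻¹' C ∩ ⋂ j, (fun p : α × (Fin n → α) => (p.2 j, p.1)) ⁻¹' {p : α × α | r p.1 p.2} := by
      ext p
      simp [hT]
    rw [h]
    exact (measurable_fst hC).inter (MeasurableSet.iInter fun j =>
      (by fun_prop : Measurable fun p : α × (Fin n → α) => (p.2 j, p.1)) hr)
  have hpre : {g : Fin (n + 1) → α | g i ∈ C ∧ ∀ j ≠ i, r (g j) (g i)}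
      = MeasurableEquiv.piFinSuccAbove (fun _ => α) i ⁻¹' T := by
    ext g
    simp only [Set.mem_ofPred_eq, Set.mem_preimage, hT, MeasurableEquiv.piFinSuccAbove_apply,
      Fin.insertNthEquiv_symm_apply, Fin.removeNth]
    refine and_congr_right fun _ => ⟨fun h j => h _ (Fin.succAbove_ne i j), fun h j hj => ?_⟩
    obtain ⟨k, rfl⟩ := Fin.exists_succAbove_eq hj
    exact h k
  rw [hpre, hmp.measure_preimage hTm.nullMeasurableSet, Measure.prod_apply hTm,
    ← lintegral_indicator hC]
  refine lintegral_congr fun z => ?_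
  by_cases hz : z ∈ C
  · rw [Set.indicator_of_mem hz]
    have : Prod.mk z ⁻¹' T = Set.univ.pi fun _ : Fin n => {w | r w z} := by
      ext g
      simp [hT, hz]
    rw [this, Measure.pi_pi]
    simp
  · rw [Set.indicator_of_notMem hz]
    have : Prod.mk z ⁻¹' T = ∅ := by
      ext g
      simp [hT, hz]
    rw [this, measure_empty]

theorem one_sub_exp_neg_mem_Icc {z : ℝ} (hz : 0 ≤ z) :
    1 - Real.exp (-z) ∈ Set.Icc (0 : ℝ) 1 := by
  have h : Real.exp (-z) ≤ 1 := Real.exp_le_one_iff.2 (by linarith)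
  exact ⟨by linarith, by linarith [Real.exp_pos (-z)]⟩

theorem exp_sub_exp_mem_Icc {b x s : ℝ} (hb : 0 < b) (hx : 0 < x) (hxs : x ≤ s) :
    Real.exp (-(b * x)) - Real.exp (-(b * (s ^ 2 / x))) ∈ Set.Icc (0 : ℝ) 1 := by
  have h1 : x ≤ s ^ 2 / x := by
    rw [le_div_iff₀ hx, sq]
    exact mul_le_mul hxs hxs hx.le (hx.le.trans hxs)
  have h2 : Real.exp (-(b * (s ^ 2 / x))) ≤ Real.exp (-(b * x)) := by gcongr
  have h3 := (one_sub_exp_neg_mem_Icc (mul_pos hb hx).le).1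
  exact ⟨by linarith, by linarith [Real.exp_pos (-(b * (s ^ 2 / x)))]⟩

theorem weakHop_integrand_nonneg {a b x s : ℝ} (ha : 0 < a) (hb : 0 < b) (n : ℕ) (hx : 0 < x)
    (hxs : x ≤ s) : 0 ≤ a * Real.exp (-(a * x)) * ((1 - Real.exp (-((a + b) * x))) ^ n *
      (Real.exp (-(b * x)) - Real.exp (-(b * (s ^ 2 / x))))) := by
  have h1 := (exp_sub_exp_mem_Icc hb hx hxs).1
  have h2 := (one_sub_exp_neg_mem_Icc (z := (a + b) * x) (by positivity)).1
  positivity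

theorem weakHopIntegral_nonneg {a b : ℝ} (ha : 0 < a) (hb : 0 < b) (n : ℕ) {s : ℝ} (hs : 0 < s) :
    0 ≤ weakHopIntegral a b n s := by
  rw [weakHopIntegral, intervalIntegral.integral_of_le hs.le]
  exact setIntegral_nonneg measurableSet_Ioc fun x hx =>
    weakHop_integrand_nonneg ha hb n hx.1 hx.2

/-- The integrand lives on `(0, s]`: the density vanishes for negative `x`, and for `x > s` the
difference of exponentials is nonpositive and is truncated to `0` by `ENNReal.ofReal`. -/
theorem lintegral_expMeasure_eq_weakHopIntegral {a b : ℝ} (ha : 0 < a) (hb : 0 < b) (n : ℕ)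
    {s : ℝ} (hs : 0 < s) :
    ∫⁻ x, ENNReal.ofReal (1 - Real.exp (-((a + b) * x))) ^ n *
      ENNReal.ofReal (Real.exp (-(b * x)) - Real.exp (-(b * (s ^ 2 / x)))) ∂expMeasure a
      = ENNReal.ofReal (weakHopIntegral a b n s) := by
  have hexp : expMeasure a = volume.withDensity (exponentialPDF a) := rfl
  have hmeas : Measurable (exponentialPDF a) := (measurable_exponentialPDFReal a).ennreal_ofReal
  rw [hexp, lintegral_withDensity_eq_lintegral_mul _ hmeas (by fun_prop), weakHopIntegral,
    intervalIntegral.integral_of_le hs.le, ofReal_integral_eq_lintegral_ofReal,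
    ← lintegral_indicator measurableSet_Ioc]
  · refine lintegral_congr fun x => ?_
    rw [Pi.mul_apply]
    by_cases hx : x ∈ Set.Ioc 0 s
    · have h1 := (exp_sub_exp_mem_Icc hb hx.1 hx.2).1
      have h2 := (one_sub_exp_neg_mem_Icc (z := (a + b) * x)
        (mul_nonneg (by positivity) hx.1.le)).1
      rw [Set.indicator_of_mem hx, exponentialPDF_of_nonneg hx.1.le,
        ENNReal.ofReal_mul (p := a * Real.exp (-(a * x))) (by positivity),
        ENNReal.ofReal_mul (pow_nonneg h2 n), ENNReal.ofReal_pow h2]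
    · rw [Set.indicator_of_notMem hx]
      rcases lt_trichotomy x 0 with h | rfl | h
      · rw [exponentialPDF_of_neg h, zero_mul]
      -- Here `s ^ 2 / 0 = 0`, so the two exponentials cancel.
      · simp
      · have hsx : s < x := not_le.1 fun hxs => hx ⟨h, hxs⟩
        have h1 : s ^ 2 / x ≤ x := by
          rw [div_le_iff₀ h, sq]
          gcongr
        have h2 : Real.exp (-(b * x)) - Real.exp (-(b * (s ^ 2 / x))) ≤ 0 := by
          rw [sub_nonpos]
          gcongr
        rw [ENNReal.ofReal_of_nonpos h2, mul_zero, mul_zero]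
  · refine Measure.integrableOn_of_bounded (M := a) (by simp)
      (Measurable.aestronglyMeasurable (by fun_prop)) ?_
    refine (ae_restrict_iff' measurableSet_Ioc).2 (Eventually.of_forall fun x hx => ?_)
    rw [Real.norm_of_nonneg (weakHop_integrand_nonneg ha hb n hx.1 hx.2)]
    have h1 := exp_sub_exp_mem_Icc hb hx.1 hx.2
    have h2 := one_sub_exp_neg_mem_Icc (z := (a + b) * x) (mul_nonneg (by positivity) hx.1.le)
    have h3 := (one_sub_exp_neg_mem_Icc (z := a * x) (mul_nonneg (by positivity) hx.1.le)).1
    rw [mul_assoc]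
    refine mul_le_of_le_one_right ha.le (mul_le_one₀ (by linarith) ?_
      (mul_le_one₀ (pow_le_one₀ h2.1 h2.2) h1.1 h1.2))
    exact mul_nonneg (pow_nonneg h2.1 n) h1.1
  · exact (ae_restrict_iff' measurableSet_Ioc).2
      (Eventually.of_forall fun x hx => weakHop_integrand_nonneg ha hb n hx.1 hx.2)

theorem setLIntegral_prod_eq {α β : Type*} [MeasurableSpace α] [MeasurableSpace β]
    (μ : Measure α) (ν : Measure β) [SFinite ν] {S : Set (α × β)} (hS : MeasurableSet S)
    {H : α × β → ENNReal} (hH : Measurable H) :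
    ∫⁻ z in S, H z ∂μ.prod ν = ∫⁻ x, ∫⁻ y in Prod.mk x ⁻¹' S, H (x, y) ∂ν ∂μ := by
  rw [← lintegral_indicator hS, lintegral_prod _ (hH.indicator hS).aemeasurable]
  refine lintegral_congr fun x => ?_
  rw [← lintegral_indicator (measurable_prodMk_left hS)]
  rfl

theorem setLIntegral_prod_symm_eq {α β : Type*} [MeasurableSpace α] [MeasurableSpace β]
    (μ : Measure α) (ν : Measure β) [SFinite μ] [SFinite ν] {S : Set (α × β)}
    (hS : MeasurableSet S) {H : α × β → ENNReal} (hH : Measurable H) :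
    ∫⁻ z in S, H z ∂μ.prod ν = ∫⁻ y, ∫⁻ x in (fun x => (x, y)) ⁻¹' S, H (x, y) ∂μ ∂ν := by
  rw [← lintegral_indicator hS, lintegral_prod_symm _ (hH.indicator hS).aemeasurable]
  refine lintegral_congr fun y => ?_
  rw [← lintegral_indicator (measurable_prodMk_right hS)]
  rfl

/-- The region is cut along the diagonal and each piece is integrated over the stronger gain first.
With weaker gain `x`, the stronger one ranges between `x` and `s ^ 2 / x`, and the minimum is
constant there. -/
theorem setLIntegral_gainLaw_eq {a b : ℝ} (ha : 0 < a) (hb : 0 < b) (n : ℕ) {s : ℝ} (hs : 0 < s) :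
    ∫⁻ z in {z : ℝ × ℝ | z.1 * z.2 < s ^ 2},
      ENNReal.ofReal (1 - Real.exp (-((a + b) * min z.1 z.2))) ^ n ∂gainLaw a b
      = ENNReal.ofReal (weakHopIntegral a b n s + weakHopIntegral b a n s) := by
  have := isProbabilityMeasure_expMeasure ha
  have := isProbabilityMeasure_expMeasure hb
  have hA : MeasurableSet {z : ℝ × ℝ | z.1 * z.2 < s ^ 2} :=
    measurableSet_lt (by fun_prop) (by fun_prop)
  have hB : MeasurableSet {z : ℝ × ℝ | z.1 ≤ z.2} := measurableSet_le (by fun_prop) (by fun_prop)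
  have hH : Measurable fun z : ℝ × ℝ =>
    ENNReal.ofReal (1 - Real.exp (-((a + b) * min z.1 z.2))) ^ n := by fun_prop
  rw [← lintegral_inter_add_sdiff _ _ hB, gainLaw, setLIntegral_prod_eq _ _ (hA.inter hB) hH,
    setLIntegral_prod_symm_eq _ _ (hA.diff hB) hH,
    ENNReal.ofReal_add (weakHopIntegral_nonneg ha hb n hs) (weakHopIntegral_nonneg hb ha n hs),
    ← lintegral_expMeasure_eq_weakHopIntegral ha hb n hs,
    ← lintegral_expMeasure_eq_weakHopIntegral hb ha n hs]
  congr 1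
  · refine lintegral_congr_ae ((ae_pos_expMeasure ha).mono fun x hx => ?_)
    have hset : Prod.mk x ⁻¹' ({z : ℝ × ℝ | z.1 * z.2 < s ^ 2} ∩ {z | z.1 ≤ z.2})
        = Set.Ico x (s ^ 2 / x) := by
      ext y
      simp only [Set.mem_preimage, Set.mem_inter_iff, Set.mem_ofPred_eq, Set.mem_Ico,
        lt_div_iff₀' hx, and_comm]
    dsimp only
    rw [hset, setLIntegral_congr_fun (g := fun _ =>
      ENNReal.ofReal (1 - Real.exp (-((a + b) * x))) ^ n) measurableSet_Ico
      (fun y hy => by simp only [min_eq_left hy.1]), setLIntegral_const,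
      expMeasure_Ico hb hx.le (by positivity)]
  · refine lintegral_congr_ae ((ae_pos_expMeasure hb).mono fun y hy => ?_)
    have hset : (fun x => (x, y)) ⁻¹' ({z : ℝ × ℝ | z.1 * z.2 < s ^ 2} \ {z | z.1 ≤ z.2})
        = Set.Ioo y (s ^ 2 / y) := by
      ext x
      simp only [Set.mem_preimage, Set.mem_sdiff, Set.mem_ofPred_eq, Set.mem_Ioo,
        lt_div_iff₀ hy, not_le, and_comm]
    dsimp only
    rw [hset, setLIntegral_congr_fun (g := fun _ =>
      ENNReal.ofReal (1 - Real.exp (-((b + a) * y))) ^ n) measurableSet_Ioo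
      (fun x hx => by simp only [min_eq_right hx.1.le, add_comm]), setLIntegral_const,
      expMeasure_Ioo ha hy.le (by positivity)]

theorem measurableSet_forall_ne_rel {α : Type*} [MeasurableSpace α] {N : ℕ} (i : Fin N)
    {C : Set α} (hC : MeasurableSet C)
    {r : α → α → Prop} (hr : MeasurableSet {p : α × α | r p.1 p.2}) :
    MeasurableSet {g : Fin N → α | g i ∈ C ∧ ∀ j ≠ i, r (g j) (g i)} := by
  have h : {g : Fin N → α | g i ∈ C ∧ ∀ j ≠ i, r (g j) (g i)} = (fun g => g i) ⁻¹' C ∩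
      ⋂ j, ⋂ (_ : j ≠ i), (fun g : Fin N → α => (g j, g i)) ⁻¹' {p : α × α | r p.1 p.2} := by
    ext g
    simp
  rw [h]
  exact (measurable_pi_apply i hC).inter (MeasurableSet.iInter fun j => MeasurableSet.iInter
    fun _ => (by fun_prop : Measurable fun g : Fin N → α => (g j, g i)) hr)

theorem pi_gainLaw_best_relay {a b : ℝ} (ha : 0 < a) (hb : 0 < b) {n : ℕ} (i : Fin (n + 1))
    {s : ℝ} (hs : 0 < s) {r : ℝ → ℝ → Prop}
    (hr : MeasurableSet {p : (ℝ × ℝ) × (ℝ × ℝ) | r (min p.1.1 p.1.2) (min p.2.1 p.2.2)})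
    (hQ : ∀ m : ℝ, 0 ≤ m → gainLaw a b {w | r (min w.1 w.2) m}
      = ENNReal.ofReal (1 - Real.exp (-((a + b) * m)))) :
    Measure.pi (fun _ : Fin (n + 1) => gainLaw a b)
      {g | g i ∈ {z : ℝ × ℝ | z.1 * z.2 < s ^ 2} ∧
        ∀ j ≠ i, r (min (g j).1 (g j).2) (min (g i).1 (g i).2)}
      = ENNReal.ofReal (weakHopIntegral a b n s + weakHopIntegral b a n s) := by
  have := isProbabilityMeasure_gainLaw ha hb
  have hA : MeasurableSet {z : ℝ × ℝ | z.1 * z.2 < s ^ 2} :=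
    measurableSet_lt (by fun_prop) (by fun_prop)
  rw [pi_setOf_forall_ne_rel (gainLaw a b) i hA
    (r := fun w z : ℝ × ℝ => r (min w.1 w.2) (min z.1 z.2)) hr,
    ← setLIntegral_gainLaw_eq ha hb n hs]
  refine lintegral_congr_ae (ae_restrict_of_ae ((ae_pos_gainLaw ha hb).mono fun z hz => ?_))
  dsimp only
  rw [hQ _ (le_min hz.1.le hz.2.le)]

/-! ### The selected relay. -/

section Opportunistic

variable {Ω : Type*} [MeasurableSpace Ω] {μ : Measure Ω} {a b : ℝ} {n : ℕ}
  {X Y : Fin (n + 1) → Ω → ℝ} {sel : Ω → Fin (n + 1)}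

/-- The choice at ties is arbitrary and `sel` need not be measurable, so the event is sandwiched: it
lies in the union over `i` of "relay `i` is weakly best" and contains the disjoint union of "relay
`i` is strictly best". Both bounds coincide because the gains have continuous laws. -/
theorem measure_selected_mul_lt (ha : 0 < a) (hb : 0 < b)
    (hlaw : HasLaw (fun ω i => (X i ω, Y i ω)) (Measure.pi fun _ : Fin (n + 1) => gainLaw a b) μ)
    (hsel : IsOpportunistic X Y sel) {s : ℝ} (hs : 0 < s) :
    μ {ω | X (sel ω) ω * Y (sel ω) ω < s ^ 2}
      = ENNReal.ofReal ((n + 1) * (weakHopIntegral a b n s + weakHopIntegral b a n s)) := by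
  have hA : MeasurableSet {z : ℝ × ℝ | z.1 * z.2 < s ^ 2} :=
    measurableSet_lt (by fun_prop) (by fun_prop)
  have hle : MeasurableSet
      {p : (ℝ × ℝ) × (ℝ × ℝ) | min p.1.1 p.1.2 ≤ min p.2.1 p.2.2} :=
    measurableSet_le (by fun_prop) (by fun_prop)
  have hlt : MeasurableSet
      {p : (ℝ × ℝ) × (ℝ × ℝ) | min p.1.1 p.1.2 < min p.2.1 p.2.2} :=
    measurableSet_lt (by fun_prop) (by fun_prop)
  have hsum : ENNReal.ofReal ((n + 1) * (weakHopIntegral a b n s + weakHopIntegral b a n s))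
      = ∑ _i : Fin (n + 1),
        ENNReal.ofReal (weakHopIntegral a b n s + weakHopIntegral b a n s) := by
    rw [ENNReal.ofReal_mul (by positivity), Finset.sum_const, Finset.card_fin, nsmul_eq_mul,
      ← Nat.cast_add_one, ENNReal.ofReal_natCast]
  rw [hsum]
  refine le_antisymm ?_ ?_
  · refine (measure_mono (t := ⋃ i, {ω | X i ω * Y i ω < s ^ 2 ∧
      ∀ j ≠ i, min (X j ω) (Y j ω) ≤ min (X i ω) (Y i ω)}) fun ω hω => ?_).trans
      ((measure_iUnion_fintype_le _ _).trans (Finset.sum_le_sum fun i _ => ?_))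
    · exact Set.mem_iUnion.2 ⟨sel ω, hω, fun j _ => hsel ω j⟩
    · refine le_of_eq ?_
      rw [← pi_gainLaw_best_relay ha hb i hs hle fun m hm => gainLaw_min_le ha hb hm]
      exact hlaw.measure_eq (measurableSet_forall_ne_rel i hA
        (r := fun w z : ℝ × ℝ => min w.1 w.2 ≤ min z.1 z.2) hle)
  · set B : Fin (n + 1) → Set (Fin (n + 1) → ℝ × ℝ) := fun i =>
      {g | g i ∈ {z : ℝ × ℝ | z.1 * z.2 < s ^ 2} ∧
        ∀ j ≠ i, min (g j).1 (g j).2 < min (g i).1 (g i).2} with hB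
    have hBm : ∀ i, MeasurableSet (B i) := fun i => measurableSet_forall_ne_rel i hA
      (r := fun w z : ℝ × ℝ => min w.1 w.2 < min z.1 z.2) hlt
    have hdisj : Pairwise (Function.onFun Disjoint B) := fun i j hij =>
      Set.disjoint_left.2 fun g hi hj => lt_asymm (hi.2 j hij.symm) (hj.2 i hij)
    have hBsum : ∑ _i : Fin (n + 1),
        ENNReal.ofReal (weakHopIntegral a b n s + weakHopIntegral b a n s)
        = Measure.pi (fun _ : Fin (n + 1) => gainLaw a b) (⋃ i, B i) := by
      rw [measure_iUnion hdisj hBm, tsum_fintype]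
      exact Finset.sum_congr rfl fun i _ =>
        (pi_gainLaw_best_relay ha hb i hs hlt fun m hm => gainLaw_min_lt ha hb hm).symm
    rw [hBsum, ← hlaw.map_eq, Measure.map_apply_of_aemeasurable hlaw.aemeasurable
      (MeasurableSet.iUnion hBm)]
    refine measure_mono fun ω hω => ?_
    obtain ⟨i, hi⟩ := Set.mem_iUnion.1 hω
    have hi' : sel ω = i := by
      by_contra h
      exact absurd (hi.2 _ h) (not_lt.2 (hsel ω i))
    rw [Set.mem_ofPred_eq, hi']
    exact hi.1

/-- If the best relay has a gain at most `ε`, then so does each of the `n + 1` independent relays.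
-/
theorem measure_selected_le (ha : 0 < a) (hb : 0 < b)
    (hlaw : HasLaw (fun ω i => (X i ω, Y i ω)) (Measure.pi fun _ : Fin (n + 1) => gainLaw a b) μ)
    (hsel : IsOpportunistic X Y sel) {ε : ℝ} (hε : 0 ≤ ε) :
    μ {ω | X (sel ω) ω ≤ ε} ≤ ENNReal.ofReal (((a + b) * ε) ^ (n + 1)) := by
  have := isProbabilityMeasure_gainLaw ha hb
  have hm : MeasurableSet {w : ℝ × ℝ | min w.1 w.2 ≤ ε} :=
    measurableSet_le (by fun_prop) (by fun_prop)
  calc μ {ω | X (sel ω) ω ≤ ε}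
      ≤ μ ((fun ω i => (X i ω, Y i ω)) ⁻¹'
          (Set.univ.pi fun _ : Fin (n + 1) => {w : ℝ × ℝ | min w.1 w.2 ≤ ε})) :=
        measure_mono fun ω hω i _ => (hsel ω i).trans ((min_le_left _ _).trans hω)
    _ = ENNReal.ofReal (1 - Real.exp (-((a + b) * ε))) ^ (n + 1) := by
        rw [← Measure.map_apply_of_aemeasurable hlaw.aemeasurable
          (MeasurableSet.univ_pi fun _ => hm), hlaw.map_eq, Measure.pi_pi,
          Finset.prod_const, Finset.card_fin, gainLaw_min_le ha hb hε]
    _ ≤ ENNReal.ofReal (((a + b) * ε) ^ (n + 1)) := by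
        rw [ENNReal.ofReal_pow (by positivity)]
        gcongr
        linarith [Real.add_one_le_exp (-((a + b) * ε))]

theorem ae_gains_pos (ha : 0 < a) (hb : 0 < b)
    (hlaw : HasLaw (fun ω i => (X i ω, Y i ω)) (Measure.pi fun _ : Fin (n + 1) => gainLaw a b) μ) :
    ∀ᵐ ω ∂μ, ∀ i, 0 < X i ω ∧ 0 < Y i ω := by
  have := isProbabilityMeasure_gainLaw ha hb
  have h : ∀ᵐ g ∂(Measure.pi fun _ : Fin (n + 1) => gainLaw a b), ∀ i, 0 < (g i).1 ∧ 0 < (g i).2 :=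
    ae_all_iff.2 fun i => (Measure.quasiMeasurePreserving_eval
      (fun _ : Fin (n + 1) => gainLaw a b) i).ae (p := fun z => 0 < z.1 ∧ 0 < z.2)
        (ae_pos_gainLaw ha hb)
  rw [← hlaw.map_eq] at h
  exact ae_of_ae_map hlaw.aemeasurable h

end Opportunistic

/-! ### Comparison of outage with a small product of gains. -/

namespace RelayNetwork

/-- The independent family indexed by `Fin N ⊕ Fin N` is regrouped into one pair of gains per relay.
-/
theorem IsRayleigh.hasLaw_gains {S : RelayNetwork} {Ω : Type*} [MeasurableSpace Ω] {μ : Measure Ω}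
    {N : ℕ} {gsr grd : Fin N → Ω → ℝ} (h : S.IsRayleigh μ gsr grd) (hsr : 0 < S.lamSR)
    (hrd : 0 < S.lamRD) :
    HasLaw (fun ω i => (gsr i ω, grd i ω))
      (Measure.pi fun _ : Fin N => gainLaw (1 / S.lamSR) (1 / S.lamRD)) μ := by
  have := isProbabilityMeasure_expMeasure (one_div_pos.2 hsr)
  have := isProbabilityMeasure_expMeasure (one_div_pos.2 hrd)
  set law : Fin N ⊕ Fin N → Measure ℝ :=
    Sum.elim (fun _ => expMeasure (1 / S.lamSR)) fun _ => expMeasure (1 / S.lamRD) with hlaw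
  have hprob : ∀ k, IsProbabilityMeasure (law k) := by
    rintro (i | i) <;> simp only [hlaw, Sum.elim_inl, Sum.elim_inr] <;> assumption
  have hk : ∀ k, HasLaw (Sum.elim gsr grd k) (law k) μ := by
    rintro (i | i)
    · exact h.law_sr i
    · exact h.law_rd i
  have h1 : HasLaw (fun ω k => Sum.elim gsr grd k ω) (Measure.pi law) μ :=
    h.indep.hasLaw_pi hk
  have h2 := measurePreserving_sumPiEquivProdPi law
  have h3 := (measurePreserving_arrowProdEquivProdArrow ℝ ℝ (Fin N)
    (fun _ => expMeasure (1 / S.lamSR)) fun _ => expMeasure (1 / S.lamRD)).symm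
  exact h3.comp_hasLaw (h2.comp_hasLaw h1)

theorem gam_pos {S : RelayNetwork} (hθ0 : 0 < S.θ) (hR : 0 < S.R) : 0 < S.gam := by
  have : 0 < 2 * S.R / S.θ := by positivity
  rw [gam]
  linarith [Real.add_one_lt_exp this.ne']

/-- Circuit consumption only lowers the relay power, so ignoring it gives a sufficient condition for
outage at every `P > 0`. -/
theorem outage_of_mul_lt {S : RelayNetwork} (hθ0 : 0 < S.θ) (hθ1 : S.θ < 1) (hν : 1 ≤ S.ν)
    (hproc : 0 ≤ S.Pproc) (hactive : 0 ≤ S.Pactive) {P x y : ℝ} (hP : 0 < P) (hx : 0 < x)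
    (hy : 0 < y) (hxy : x * y < S.gam * S.ν * S.θ / (2 * (1 - S.θ)) / P) : S.Outage P P x y := by
  have hc : 0 ≤ S.circuitEnergy := by unfold circuitEnergy; positivity
  have hνθ : 0 < S.ν * (S.θ / 2) := by positivity
  have h1θ : 0 < 1 - S.θ := by linarith
  by_contra hout
  simp only [Outage, CircuitOutage, RateOutage, not_or, not_lt] at hout
  obtain ⟨h1, h2⟩ := hout
  have hr : 0 ≤ S.relayPower P x := div_nonneg (sub_nonneg.2 h1) hνθ.le
  have hm : 0 ≤ min (x * P) (y * S.relayPower P x) := le_min (by positivity) (by positivity)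
  have h3 : 2 * S.R / S.θ ≤ Real.log (1 + min (x * P) (y * S.relayPower P x)) := by
    rw [div_le_iff₀ hθ0]
    linarith
  rw [Real.le_log_iff_exp_le (by linarith)] at h3
  have h4 : S.gam ≤ y * S.relayPower P x := by
    rw [gam]
    linarith [min_le_right (x * P) (y * S.relayPower P x)]
  rw [relayPower, ← mul_div_assoc, le_div_iff₀ hνθ, harvested] at h4
  rw [div_div, lt_div_iff₀ (by positivity)] at hxy
  nlinarith [mul_nonneg hy.le hc]

/-- The two entries of the maximum ensure that the first hop is decodable and that the circuits take
less than the fraction `1 - q` of the harvested energy. Only the second hop can then fail, with more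
than `q` times the circuit-free relay power. -/
theorem mul_lt_of_outage {S : RelayNetwork} (hθ0 : 0 < S.θ) (hθ1 : S.θ < 1) (hν : 1 ≤ S.ν)
    (hproc : 0 ≤ S.Pproc) (hactive : 0 ≤ S.Pactive) {P x y q : ℝ} (hP : 0 < P)
    (hy : 0 < y) (hq1 : q < 1) (hq0 : 0 < q) 
    (hx : max S.gam (S.circuitEnergy / ((1 - S.θ) * (1 - q))) / P < x)
    (hout : S.Outage P P x y) : x * y < S.gam * S.ν * S.θ / (2 * (1 - S.θ)) / q / P := by
  have hc : 0 ≤ S.circuitEnergy := by unfold circuitEnergy; positivity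
  have hνθ : 0 < S.ν * (S.θ / 2) := by positivity
  have h1θ : 0 < 1 - S.θ := by linarith
  have h1q : 0 < 1 - q := by linarith
  rw [div_lt_iff₀ hP, max_lt_iff, div_lt_iff₀ (by positivity)] at hx
  obtain ⟨hx1, hx2⟩ := hx
  have hx0 : 0 < x * P := (pos_of_mul_pos_left
    (lt_of_le_of_lt hc hx2) (by positivity))
  have hE : 0 < S.harvested P x - S.circuitEnergy := by
    rw [harvested]
    nlinarith [mul_pos (mul_pos hx0 h1θ) hq0]
  rcases hout with h | h
  · exact absurd h (not_lt.2 (by linarith))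
  have hr : 0 ≤ S.relayPower P x := div_nonneg hE.le hνθ.le
  have hm : 0 ≤ min (x * P) (y * S.relayPower P x) := le_min (by positivity) (by positivity)
  have h3 : Real.log (1 + min (x * P) (y * S.relayPower P x)) < 2 * S.R / S.θ := by
    rw [RateOutage] at h
    rw [lt_div_iff₀ hθ0]
    linarith
  rw [Real.log_lt_iff_lt_exp (by linarith)] at h3
  have h4 : y * S.relayPower P x < S.gam := by
    have h5 : min (x * P) (y * S.relayPower P x) < S.gam := by
      rw [gam]
      linarith
    exact (min_lt_iff.1 h5).resolve_left (not_lt.2 hx1.le)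
  rw [relayPower, ← mul_div_assoc, div_lt_iff₀ hνθ, harvested] at h4
  rw [div_div, div_div, lt_div_iff₀ (by positivity)]
  nlinarith [mul_lt_mul_of_pos_left hx2 hy]

end RelayNetwork

/-! ### High-SNR limit of the rescaled probabilities. -/

theorem tendsto_measureReal_selected_mul_lt {Ω : Type*} [MeasurableSpace Ω] {μ : Measure Ω}
    {lx ly : ℝ} (hlx : 0 < lx) (hly : 0 < ly) {n : ℕ} (hn : 1 ≤ n) {X Y : Fin (n + 1) → Ω → ℝ}
    {sel : Ω → Fin (n + 1)}
    (hlaw : HasLaw (fun ω i => (X i ω, Y i ω))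
      (Measure.pi fun _ : Fin (n + 1) => gainLaw (1 / lx) (1 / ly)) μ)
    (hsel : IsOpportunistic X Y sel) {κ : ℝ} (hκ : 0 < κ) :
    Tendsto (fun P : ℝ => μ.real {ω | X (sel ω) ω * Y (sel ω) ω < κ / P}
        * P ^ ((((n + 1 : ℕ) : ℝ) + 1) / 2)) atTop
      (𝓝 (omegaConst (n + 1) lx ly * κ ^ ((((n + 1 : ℕ) : ℝ) + 1) / 2))) := by
  set d : ℝ := (((n + 1 : ℕ) : ℝ) + 1) / 2 with hd
  set a := 1 / lx with ha'
  set b := 1 / ly with hb'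
  have ha : 0 < a := one_div_pos.2 hlx
  have hb : 0 < b := one_div_pos.2 hly
  have hn0 : (0 : ℝ) < n := by exact_mod_cast hn
  have hΩ : omegaConst (n + 1) lx ly = (n + 1) * (a * b * (a + b) ^ n * (1 / n - 1 / (n + 2))
      + b * a * (b + a) ^ n * (1 / n - 1 / (n + 2))) := by
    rw [omegaConst_eq (by omega) hlx hly, ha', hb', Nat.add_sub_cancel]
    have e1 : 1 / lx + 1 / ly = (lx + ly) / (lx * ly) := by field_simp; ring
    have e2 : 1 / ly + 1 / lx = (lx + ly) / (lx * ly) := by field_simp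
    rw [e1, e2, div_pow, pow_succ (lx * ly)]
    push_cast
    have e3 : ((n : ℝ) + 1) ^ 2 - 1 = n * (n + 2) := by ring
    rw [e3]
    generalize (lx + ly) ^ n = T
    have h0 : (lx * ly) ^ n ≠ 0 := by positivity
    generalize (lx * ly) ^ n = U at *
    field_simp
    ring
  have hs : Tendsto (fun P : ℝ => √(κ / P)) atTop (𝓝[>] 0) := by
    refine tendsto_nhdsWithin_iff.2 ⟨?_, ?_⟩
    · have : Tendsto (fun P : ℝ => κ / P) atTop (𝓝 0) := tendsto_const_nhds.div_atTop tendsto_id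
      simpa [Function.comp_def] using (Real.continuous_sqrt.tendsto 0).comp this
    · exact (eventually_gt_atTop 0).mono fun P hP => Real.sqrt_pos.2 (div_pos hκ hP)
  have hJ := ((((tendsto_weakHopIntegral ha hb hn).comp hs).add
    ((tendsto_weakHopIntegral hb ha hn).comp hs)).const_mul ((n : ℝ) + 1)).mul_const (κ ^ d)
  rw [← hΩ] at hJ
  refine hJ.congr' ((eventually_gt_atTop 0).mono fun P hP => ?_)
  have hsP : 0 < √(κ / P) := Real.sqrt_pos.2 (div_pos hκ hP)
  have hsq : √(κ / P) ^ 2 = κ / P := Real.sq_sqrt (div_pos hκ hP).le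
  -- With `N = n + 1`, the exponent `n + 2` is `N + 1 = 2 * d`; this is the source of the
  -- half-integer order.
  have hpow : √(κ / P) ^ (n + 2) = κ ^ d / P ^ d := by
    rw [← Real.div_rpow hκ.le hP.le, Real.sqrt_eq_rpow, ← Real.rpow_natCast,
      ← Real.rpow_mul (div_pos hκ hP).le, hd]
    congr 1
    push_cast
    ring
  have hG : μ.real {ω | X (sel ω) ω * Y (sel ω) ω < κ / P}
      = (n + 1) * (weakHopIntegral a b n √(κ / P) + weakHopIntegral b a n √(κ / P)) := by
    rw [← hsq, measureReal_def, measure_selected_mul_lt ha hb hlaw hsel hsP, hsq,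
      ENNReal.toReal_ofReal]
    have := weakHopIntegral_nonneg ha hb n hsP
    have := weakHopIntegral_nonneg hb ha n hsP
    positivity
  have h1 : κ ^ d ≠ 0 := (Real.rpow_pos_of_pos hκ d).ne'
  have h2 : P ^ d ≠ 0 := (Real.rpow_pos_of_pos hP d).ne'
  simp only [Function.comp_apply]
  rw [hG, hpow]
  field_simp

namespace RelayNetwork

variable {Ω : Type*} [MeasurableSpace Ω] {μ : Measure Ω} {S : RelayNetwork}

theorem tendsto_outageProb_mul_rpow [IsProbabilityMeasure μ]
    (hθ0 : 0 < S.θ) (hθ1 : S.θ < 1) (hR : 0 < S.R) (hν : 1 ≤ S.ν)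
    (hproc : 0 ≤ S.Pproc) (hactive : 0 ≤ S.Pactive) (hsr : 0 < S.lamSR) (hrd : 0 < S.lamRD)
    {N : ℕ} (hN : 2 ≤ N) {gsr grd : Fin N → Ω → ℝ} (hfading : S.IsRayleigh μ gsr grd)
    {sel : Ω → Fin N} (hsel : IsOpportunistic gsr grd sel) :
    Tendsto (fun P : ℝ => S.outageProb μ gsr grd sel P P * P ^ (((N : ℝ) + 1) / 2)) atTop
      (𝓝 (omegaConst N S.lamSR S.lamRD
        * (S.gam * S.ν * S.θ / (2 * (1 - S.θ))) ^ (((N : ℝ) + 1) / 2))) := by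
  obtain ⟨n, rfl⟩ : ∃ n, N = n + 1 := ⟨N - 1, by omega⟩
  have hn : 1 ≤ n := by omega
  have hlaw := hfading.hasLaw_gains hsr hrd
  have ha : 0 < 1 / S.lamSR := one_div_pos.2 hsr
  have hb : 0 < 1 / S.lamRD := one_div_pos.2 hrd
  have hgam := gam_pos hθ0 hR
  have h1θ : 0 < 1 - S.θ := by linarith
  set d : ℝ := (((n + 1 : ℕ) : ℝ) + 1) / 2 with hd
  set K : ℝ := S.gam * S.ν * S.θ / (2 * (1 - S.θ)) with hK
  have hKpos : 0 < K := by positivity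
  have hpos := ae_gains_pos ha hb hlaw
  refine tendsto_order.2 ⟨fun c hc => ?_, fun c hc => ?_⟩
  · filter_upwards [(tendsto_measureReal_selected_mul_lt hsr hrd hn hlaw hsel
      hKpos).eventually (lt_mem_nhds hc), eventually_gt_atTop 0] with P hP hP0
    refine hP.trans_le ?_
    gcongr
    refine ENNReal.toReal_mono (measure_ne_top _ _) (measure_mono_ae ?_)
    filter_upwards [hpos] with ω hω h
    exact outage_of_mul_lt hθ0 hθ1 hν hproc hactive hP0 (hω _).1 (hω _).2 h
  -- By continuity at `q = 1`, replacing `K` by `K / q` keeps the limit below `c` for some `q < 1`.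
  · obtain ⟨q, hqc, hq0, hq1⟩ : ∃ q : ℝ,
        omegaConst (n + 1) S.lamSR S.lamRD * (K / q) ^ d < c ∧ 0 < q ∧ q < 1 := by
      have hcont : Tendsto (fun q : ℝ => omegaConst (n + 1) S.lamSR S.lamRD * (K / q) ^ d)
          (𝓝[<] 1) (𝓝 (omegaConst (n + 1) S.lamSR S.lamRD * K ^ d)) := by
        have h : ContinuousAt
            (fun q : ℝ => omegaConst (n + 1) S.lamSR S.lamRD * (K / q) ^ d) 1 := by
          refine continuousAt_const.mul (ContinuousAt.rpow_const
            (continuousAt_const.div continuousAt_id one_ne_zero) (Or.inl ?_))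
          simpa using hKpos.ne'
        simpa using h.tendsto.mono_left nhdsWithin_le_nhds
      exact ((hcont.eventually (gt_mem_nhds hc)).and
        (Ioo_mem_nhdsLT (zero_lt_one (α := ℝ)))).exists
    set C : ℝ := max S.gam (S.circuitEnergy / ((1 - S.θ) * (1 - q))) with hC
    have hCpos : 0 < C := lt_max_of_lt_left hgam
    -- The exceptional event is negligible: `n + 1 - d = n / 2 > 0`.
    have hsmall : Tendsto (fun P : ℝ => ((1 / S.lamSR + 1 / S.lamRD) * (C / P)) ^ (n + 1) * P ^ d)
        atTop (𝓝 0) := by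
      have h := (tendsto_rpow_neg_atTop (y := (n : ℝ) + 1 - d) (by
        rw [hd]
        push_cast
        have : (1 : ℝ) ≤ n := by exact_mod_cast hn
        linarith)).const_mul (((1 / S.lamSR + 1 / S.lamRD) * C) ^ (n + 1))
      rw [mul_zero] at h
      refine h.congr' ((eventually_gt_atTop 0).mono fun P hP => ?_)
      have e : -((n : ℝ) + 1 - d) = d - ((n + 1 : ℕ) : ℝ) := by push_cast; ring
      dsimp only
      rw [e, Real.rpow_sub hP, Real.rpow_natCast, ← mul_div_assoc _ C P, div_pow]
      ring
    have hlim := (tendsto_measureReal_selected_mul_lt hsr hrd hn hlaw hsel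
      (div_pos hKpos hq0)).add hsmall
    rw [add_zero] at hlim
    filter_upwards [hlim.eventually (gt_mem_nhds hqc), eventually_gt_atTop 0] with P hP hP0
    refine lt_of_le_of_lt ?_ hP
    rw [← add_mul]
    gcongr
    have hCP : 0 ≤ C / P := by positivity
    have hle : μ.real {ω | gsr (sel ω) ω ≤ C / P}
        ≤ ((1 / S.lamSR + 1 / S.lamRD) * (C / P)) ^ (n + 1) :=
      ENNReal.toReal_le_of_le_ofReal (by positivity) (measure_selected_le ha hb hlaw hsel hCP)
    refine le_trans ?_ ((measureReal_union_le _ _).trans (add_le_add_right hle _))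
    refine ENNReal.toReal_mono (measure_ne_top _ _) (measure_mono_ae ?_)
    filter_upwards [hpos] with ω hω h
    by_cases hx : gsr (sel ω) ω ≤ C / P
    · exact Or.inr hx
    · exact Or.inl (mul_lt_of_outage hθ0 hθ1 hν hproc hactive hP0 (hω _).2 hq1 hq0
        (not_le.1 hx) h)

end RelayNetwork

/-! ### From the rescaled limit to the three claims. -/

theorem omegaConst_pos {N : ℕ} (hN : 2 ≤ N) {a b : ℝ} (ha : 0 < a) (hb : 0 < b) :
    0 < omegaConst N a b := by
  have : (2 : ℝ) ≤ N := by exact_mod_cast hN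
  have : 0 < (N : ℝ) ^ 2 - 1 := by nlinarith
  rw [omegaConst_eq hN ha hb]
  positivity

/-- For large `P`, `-log p / log P = d - log (p * P ^ d) / log P`, and the last numerator converges
to `log L`. -/
theorem hasDiversityOrder_of_tendsto {p : ℝ → ℝ} {d L : ℝ} (hL : 0 < L)
    (h : Tendsto (fun P : ℝ => p P * P ^ d) atTop (𝓝 L)) : HasDiversityOrder p d := by
  have hlog : Tendsto (fun P : ℝ => Real.log (p P * P ^ d) / Real.log P) atTop (𝓝 0) :=
    ((Real.continuousAt_log hL.ne').tendsto.comp h).div_atTop Real.tendsto_log_atTop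
  have hlim := hlog.const_sub d
  rw [sub_zero] at hlim
  refine hlim.congr' ?_
  filter_upwards [h.eventually (lt_mem_nhds hL), eventually_gt_atTop 1] with P hP hP1
  have hP0 : 0 < P := zero_lt_one.trans hP1
  have hPd := Real.rpow_pos_of_pos hP0 d
  have hp : 0 < p P := pos_of_mul_pos_left hP hPd.le
  have hl : Real.log P ≠ 0 := (Real.log_pos hP1).ne'
  rw [Real.log_mul hp.ne' hPd.ne', Real.log_rpow hP0]
  field_simp
  ring

theorem isEquivalent_of_tendsto_mul_rpow {p : ℝ → ℝ} {d L : ℝ} (hL : 0 < L)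
    (h : Tendsto (fun P : ℝ => p P * P ^ d) atTop (𝓝 L)) :
    IsEquivalent atTop p (fun P : ℝ => L * P ^ (-d)) := by
  refine isEquivalent_of_tendsto_one ?_
  have h1 := h.div_const L
  rw [div_self hL.ne'] at h1
  refine h1.congr' ((eventually_gt_atTop 0).mono fun P hP => ?_)
  have hPd := Real.rpow_pos_of_pos hP d
  rw [Pi.div_apply, Real.rpow_neg hP.le]
  field_simp

theorem corollary1 {Ω : Type*} [MeasurableSpace Ω] (μ : Measure Ω) [IsProbabilityMeasure μ]
    (S : RelayNetwork) (hθ0 : 0 < S.θ) (hθ1 : S.θ < 1) (hR : 0 < S.R) (hν : 1 ≤ S.ν)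
    (hproc : 0 ≤ S.Pproc) (hactive : 0 ≤ S.Pactive) (hsr : 0 < S.lamSR) (hrd : 0 < S.lamRD)
    (N : ℕ) (hN : 2 ≤ N) (gsr grd : Fin N → Ω → ℝ) (hfading : S.IsRayleigh μ gsr grd)
    (sel : Ω → Fin N) (hsel : IsOpportunistic gsr grd sel) :
    IsEquivalent atTop (fun P : ℝ => S.outageProb μ gsr grd sel P P)
      (fun P : ℝ => omegaConst N S.lamSR S.lamRD
        * (S.gam * S.ν * S.θ / (2 * (1 - S.θ))) ^ (((N : ℝ) + 1) / 2)
        * P ^ (-(((N : ℝ) + 1) / 2))) ∧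
    HasDiversityOrder (fun P : ℝ => S.outageProb μ gsr grd sel P P) (((N : ℝ) + 1) / 2) ∧
    ∀ ν' : ℝ, 1 ≤ ν' →
      Tendsto (fun P : ℝ => ({S with ν := ν'} : RelayNetwork).outageProb μ gsr grd sel P P
          / S.outageProb μ gsr grd sel P P) atTop
        (𝓝 ((ν' / S.ν) ^ (((N : ℝ) + 1) / 2))) := by

  have hgam := RelayNetwork.gam_pos hθ0 hR
  have h1θ : 0 < 1 - S.θ := by linarith
  have hΩ := omegaConst_pos hN hsr hrd
  have hlim := RelayNetwork.tendsto_outageProb_mul_rpow hθ0 hθ1 hR hν hproc hactive hsr hrd hN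
    hfading hsel
  have hL : 0 < omegaConst N S.lamSR S.lamRD
      * (S.gam * S.ν * S.θ / (2 * (1 - S.θ))) ^ (((N : ℝ) + 1) / 2) := by positivity
  refine ⟨isEquivalent_of_tendsto_mul_rpow hL hlim, hasDiversityOrder_of_tendsto hL hlim,
    fun ν' hν' => ?_⟩
  -- The fading laws do not involve `ν`, so the same gains and the same selection serve both
  -- networks.
  have hfading' : ({S with ν := ν'} : RelayNetwork).IsRayleigh μ gsr grd :=
    ⟨hfading.law_sr, hfading.law_rd, hfading.indep⟩
  have hlim' := RelayNetwork.tendsto_outageProb_mul_rpow (S := {S with ν := ν'}) hθ0 hθ1 hR hν'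
    hproc hactive hsr hrd hN hfading' hsel
  have hratio := hlim'.div hlim hL.ne'
  have hK : 0 < S.gam * S.ν * S.θ / (2 * (1 - S.θ)) := by positivity
  have hconst : omegaConst N S.lamSR S.lamRD
        * (S.gam * ν' * S.θ / (2 * (1 - S.θ))) ^ (((N : ℝ) + 1) / 2)
      / (omegaConst N S.lamSR S.lamRD
        * (S.gam * S.ν * S.θ / (2 * (1 - S.θ))) ^ (((N : ℝ) + 1) / 2))
      = (ν' / S.ν) ^ (((N : ℝ) + 1) / 2) := by
    rw [mul_div_mul_left _ _ hΩ.ne', ← Real.div_rpow (by positivity) hK.le]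
    congr 1
    field_simp
  rw [← hconst]
  refine hratio.congr' ((eventually_gt_atTop 0).mono fun P hP => ?_)
  exact mul_div_mul_right _ _ (Real.rpow_pos_of_pos hP _).ne'
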